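/- Let $\mathbb{G}$ be a Carnot group, that is, a connected, simply connected, nilpotent real Lie group whose Lie algebra $\mathfrak g$ admits a stratification $\mathfrak g=V_1\oplus\dots\oplus V_k$ with $[V_1,V_i]=V_{i+1}$ for all $i\ge 1$, $V_k\neq\{0\}$ and $V_i=\{0\}$ for $i>k$, where $[V_1,V_i]$ is the span of the brackets $[X,Y]$ with $X\in V_1$, $Y\in V_i$. Let $(X_1,\dots,X_m)$ be a basis of $V_1$, regarded as left-invariant vector fields on $\mathbb{G}$, and let $dx$ be a Haar measure on $\mathbb{G}$ (Lebesgue measure when $\mathbb G$ is identified with $\mathbb R^n$ by exponential coordinates). For an open set $A\subset\mathbb{G}$ let $L^1_{\mathrm{loc}}(A)$ be the space of (a.e. classes of) functions $u:A\to\mathbb{R}$ that are integrable on every compact subset of $A$, with the topology given by the seminorms $u\mapsto\int_K|u|\,dx$, $K\subset A$ compact. Let $W^{1,1}_{\mathbb{G},\mathrm{loc}}(A)$ be the set of all $u\in L^1_{\mathrm{loc}}(A)$ for which there is $\nabla_{\mathbb{G}}u=(X_1u,\dots,X_mu)\in L^1_{\mathrm{loc}}(A)^m$ such that $$\int_A u\,X_j\varphi\,dx=-\int_A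 (X_ju)\,\varphi\,dx\qquad\text{for all }\varphi\in C_c^\infty(A),\ j=1,\dots,m.$$ Theorem. Let $f:\mathbb{R}^m\to[0,+\infty]$ be convex and lower semicontinuous and let $A\subset\mathbb{G}$ be open. Then the functional $F:W^{1,1}_{\mathbb{G},\mathrm{loc}}(A)\to[0,+\infty]$, $$F(u):=\int_A f(\nabla_{\mathbb{G}}u(x))\,dx,$$ is lower semicontinuous on $W^{1,1}_{\mathbb{G},\mathrm{loc}}(A)$ with respect to the topology induced by $L^1_{\mathrm{loc}}(A)$. -/

import Mathlib

open MeasureTheory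
open scoped Manifold ContDiff ENNReal NNReal

noncomputable section

namespace Carnot

/-- A stratification `𝔤 = V₁ ⊕ ⋯ ⊕ V_k` of a real Lie algebra (only its bracket enters the axioms):
`[V₁, V_i] = V_{i+1}` for all `i ≥ 1`, `V_k ≠ 0`, and `V_i = 0` for `i > k`. The layers are numbered
from `1`; the unused value at `0` is set to `0` (so that `V_k ≠ 0` forces `k ≥ 1`). -/
structure Stratification (𝔤 : Type*) [AddCommGroup 𝔤] [Module ℝ 𝔤] [Bracket 𝔤 𝔤] where
  step : ℕ
  layer : ℕ → Submodule ℝ 𝔤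
  isInternal : DirectSum.IsInternal (fun i : Fin step => layer (i + 1))
  span_bracket : ∀ i, 1 ≤ i →
    Submodule.span ℝ {z : 𝔤 | ∃ x ∈ layer 1, ∃ y ∈ layer i, ⁅x, y⁆ = z} = layer (i + 1)
  layer_step_ne_bot : layer step ≠ ⊥
  layer_of_step_lt : ∀ i, step < i → layer i = ⊥
  layer_zero : layer 0 = ⊥

section Defs

variable {n m : ℕ} {G : Type*} [TopologicalSpace G] [ChartedSpace (EuclideanSpace ℝ (Fin n)) G]
  [Group G]

/-- The derivative `X φ` of `φ : G → ℝ` along the left-invariant vector field `X` whose value at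
the identity is `v`. -/
def invDeriv (v : GroupLieAlgebra (𝓡 n) G) (φ : G → ℝ) (x : G) : ℝ :=
  mfderiv (𝓡 n) 𝓘(ℝ, ℝ) φ x (mulInvariantVectorField v x)

variable (n) in
/-- `φ ∈ C_c^∞(Ω)`. -/
structure IsTestFunction (Ω : Set G) (φ : G → ℝ) : Prop where
  smooth : ContMDiff (𝓡 n) 𝓘(ℝ, ℝ) ∞ φ
  hasCompactSupport : HasCompactSupport φ
  tsupport_subset : tsupport φ ⊆ Ω

variable [MeasurableSpace G]

/-- `g = (X₁u, …, X_m u)` in the sense of distributions on `Ω`. It is used only for `u` and `g`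
locally integrable on `Ω`, so that all integrals converge. -/
def IsWeakHorizontalGradient {V : Submodule ℝ (GroupLieAlgebra (𝓡 n) G)}
    (X : Module.Basis (Fin m) ℝ V) (μ : Measure G) (Ω : Set G)
    (u : G → ℝ) (g : G → EuclideanSpace ℝ (Fin m)) : Prop :=
  ∀ φ : G → ℝ, IsTestFunction n Ω φ → ∀ j : Fin m,
    ∫ x in Ω, u x * invDeriv (X j : GroupLieAlgebra (𝓡 n) G) φ x ∂μ
      = -∫ x in Ω, g x j * φ x ∂μ

/-- `L¹_loc(Ω)`: almost everywhere classes of functions on `Ω`, locally integrable on `Ω`. -/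
def L1loc (μ : Measure G) (Ω : Set G) : Type _ :=
  {u : G →ₘ[μ.restrict Ω] ℝ // LocallyIntegrableOn u Ω μ}

/-- The topology of `L¹_loc(Ω)`, given by the seminorms `u ↦ ∫_K |u|`, `K ⊆ Ω` compact: it is
generated by the balls of these seminorms. -/
instance (μ : Measure G) (Ω : Set G) : TopologicalSpace (L1loc μ Ω) :=
  TopologicalSpace.generateFrom
    {B | ∃ (v : L1loc μ Ω) (K : Set G) (ε : ℝ≥0∞), IsCompact K ∧ K ⊆ Ω ∧ 0 < ε ∧
      B = {u : L1loc μ Ω | ∫⁻ x in K, ‖u.1 x - v.1 x‖ₑ ∂μ < ε}}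

/-- `W^{1,1}_{G,loc}(Ω)`: the `u ∈ L¹_loc(Ω)` whose distributional horizontal gradient with respect
to the basis `X` of the first layer is in `L¹_loc(Ω)`. As a subtype of `L¹_loc(Ω)` it carries the
topology induced by `L¹_loc(Ω)`. -/
abbrev W11loc {V : Submodule ℝ (GroupLieAlgebra (𝓡 n) G)}
    (X : Module.Basis (Fin m) ℝ V) (μ : Measure G) (Ω : Set G) : Type _ :=
  {u : L1loc μ Ω // ∃ g : G → EuclideanSpace ℝ (Fin m),
    LocallyIntegrableOn g Ω μ ∧ IsWeakHorizontalGradient X μ Ω u.1 g}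

/-- The horizontal gradient `∇_G u` of `u ∈ W^{1,1}_{G,loc}(Ω)`; on `Ω` it is unique up to equality
almost everywhere. -/
def horizontalGradient {V : Submodule ℝ (GroupLieAlgebra (𝓡 n) G)}
    {X : Module.Basis (Fin m) ℝ V} {μ : Measure G} {Ω : Set G} (u : W11loc X μ Ω) :
    G → EuclideanSpace ℝ (Fin m) :=
  u.2.choose

end Defs

end Carnot

end

/-! ### Convex lower semicontinuous functions as suprema of affine ones. -/

section ConvexEnvelope

variable {E : Type*} [NormedAddCommGroup E] [NormedSpace ℝ E]

/-! By Hahn–Banach, `f` is a countable supremum of positive parts of affine functions `L k + b k`.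
For one affine function and an open `U ⊆ A`, the integral over `U` of the positive part of `L ∇u +
b` is the supremum of `∫ (L ∇u + b) φ` over test functions `φ` on `U` with values in `[0, 1]`.
Integration by parts moves the derivatives onto `φ`, so each of these integrals is continuous in `u`
for `L¹_loc`, and their supremum is lower semicontinuous
(`lowerSemicontinuous_setLIntegral_affine_horizontalGradient`). The supremum over `k` does not
commute with the integral, but the regions where different affine functions dominate can be
approximated from inside by compact sets and separated by disjoint open sets. This is why the affine
case is needed on every open `U`; it settles finite maxima (`lowerSemicontinuous_setLIntegral_sup`),
and monotone convergence does the rest. -/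

/-- Separation needs a real vector space, hence real heights; `0 ≤ p.2` excludes negative ones,
which `ENNReal.ofReal` would identify with `0`. -/
theorem convex_real_epigraph_ennreal {f : E → ℝ≥0∞} (hf : ConvexOn ℝ≥0 Set.univ f) :
    Convex ℝ {p : E × ℝ | 0 ≤ p.2 ∧ f p.1 ≤ ENNReal.ofReal p.2} := by
  rintro ⟨y, s⟩ ⟨hs, hy⟩ ⟨z, t⟩ ⟨ht, hz⟩ a b ha hb hab
  lift a to ℝ≥0 using ha
  lift b to ℝ≥0 using hb
  lift s to ℝ≥0 using hs
  lift t to ℝ≥0 using ht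
  have hab' : a + b = 1 := by exact_mod_cast hab
  have h := hf.2 (Set.mem_univ y) (Set.mem_univ z) zero_le zero_le hab'
  refine ⟨by simp only [Prod.snd_add, Prod.smul_snd, smul_eq_mul]; positivity, ?_⟩
  simp only [ENNReal.ofReal_coe_nnreal] at hy hz
  have e : ENNReal.ofReal ((a : ℝ) • (s : ℝ) + (b : ℝ) • (t : ℝ)) = a • (s : ℝ≥0∞) + b • (t : ℝ≥0∞) := by
    simp only [smul_eq_mul, ENNReal.smul_def]
    norm_cast
    rw [ENNReal.ofReal_coe_nnreal]
  change f (a • y + b • z) ≤ ENNReal.ofReal ((a : ℝ) • (s : ℝ) + (b : ℝ) • (t : ℝ))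
  rw [e]
  refine h.trans ?_
  simp only [ENNReal.smul_def, smul_eq_mul]
  gcongr

theorem isClosed_real_epigraph_ennreal {E : Type*} [TopologicalSpace E] {f : E → ℝ≥0∞} (hf : LowerSemicontinuous f) :
    IsClosed {p : E × ℝ | 0 ≤ p.2 ∧ f p.1 ≤ ENNReal.ofReal p.2} := by
  refine (isClosed_le continuous_const continuous_snd).inter ?_
  exact hf.isClosed_epigraph.preimage
    (continuous_fst.prodMk (ENNReal.continuous_ofReal.comp continuous_snd))

/-- A lower semicontinuous convex function with values in `[0, ∞]` lies above an affine function
which is as close to it at a given point as we wish. -/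
theorem ConvexOn.exists_affine_minorant_ennreal {f : E → ℝ≥0∞} (hf : ConvexOn ℝ≥0 Set.univ f)
    (hlsc : LowerSemicontinuous f) {x : E} {c : ℝ≥0∞} (hc : c < f x) :
    ∃ (L : E →L[ℝ] ℝ) (b : ℝ),
      (∀ y, ENNReal.ofReal (L y + b) ≤ f y) ∧ c < ENNReal.ofReal (L x + b) := by
  lift c to ℝ≥0 using hc.ne_top
  have hlt : ∀ {t : ℝ}, (c : ℝ) < t → (c : ℝ≥0∞) < ENNReal.ofReal t := fun {t} h => by
    rw [← ENNReal.ofReal_coe_nnreal]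
    exact (ENNReal.ofReal_lt_ofReal_iff_of_nonneg c.2).2 h
  by_cases hne : ∀ y, f y = ⊤
  · exact ⟨0, c + 1, fun y => by simp [hne y], hlt (by simp)⟩
  push Not at hne
  obtain ⟨y₀, hy₀⟩ := hne
  have hmem : ∀ {y : E} {t : ℝ}, f y ≠ ⊤ → (f y).toReal ≤ t →
      (y, t) ∈ {p : E × ℝ | 0 ≤ p.2 ∧ f p.1 ≤ ENNReal.ofReal p.2} := fun {y t} hy ht =>
    ⟨ENNReal.toReal_nonneg.trans ht, (ENNReal.le_ofReal_iff_toReal_le hy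
      (ENNReal.toReal_nonneg.trans ht)).2 ht⟩
  have hx : (x, (c : ℝ)) ∉ {p : E × ℝ | 0 ≤ p.2 ∧ f p.1 ≤ ENNReal.ofReal p.2} := by
    rintro ⟨-, h⟩
    simp only [ENNReal.ofReal_coe_nnreal] at h
    exact hc.not_ge h
  obtain ⟨l, u, hlx, hl⟩ := geometric_hahn_banach_point_closed (convex_real_epigraph_ennreal hf)
    (isClosed_real_epigraph_ennreal hlsc) hx
  set M : E →L[ℝ] ℝ := l.comp (ContinuousLinearMap.inl ℝ E ℝ) with hM
  set s : ℝ := l (0, 1) with hs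
  have hdec : ∀ y t, l (y, t) = M y + s * t := fun y t => by
    have : ((y, t) : E × ℝ) = (y, 0) + t • (0, 1) := by simp
    rw [this, map_add, map_smul]
    simp [hM, hs, mul_comm]
  rw [hdec] at hlx
  have hl' : ∀ y, f y ≠ ⊤ → ∀ t, (f y).toReal ≤ t → u < M y + s * t := fun y hy t ht => by
    rw [← hdec]
    exact hl _ (hmem hy ht)
  -- With `s < 0`, the separating functional would drop below `u` far up the vertical ray over `y₀`.
  have hs0 : 0 ≤ s := by
    by_contra! hneg
    have h1 := hl' y₀ hy₀ (max (f y₀).toReal ((u - M y₀) / s)) (le_max_left _ _)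
    have h2 : s * max (f y₀).toReal ((u - M y₀) / s) ≤ s * ((u - M y₀) / s) :=
      mul_le_mul_of_nonpos_left (le_max_right _ _) hneg.le
    rw [mul_div_cancel₀ _ hneg.ne] at h2
    linarith
  -- The minorant is `N * (u - M y)`. A non-vertical hyperplane gives `N = 1 / s`; a vertical one
  -- (`s = 0`) allows any large `N`. The bound `N * s ≤ 1` suffices because `f ≥ 0`.
  obtain ⟨N, hN, hN1, hN2⟩ : ∃ N : ℝ, 0 ≤ N ∧ N * s ≤ 1 ∧ c < N * (u - M x) := by
    rcases hs0.eq_or_lt with h0 | hpos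
    · rw [← h0] at hlx
      have : 0 < u - M x := by linarith
      refine ⟨(c + 1) / (u - M x), by positivity, by simp [← h0], ?_⟩
      rw [div_mul_cancel₀ _ this.ne']
      linarith
    · refine ⟨s⁻¹, by positivity, by rw [inv_mul_cancel₀ hpos.ne'], ?_⟩
      rw [inv_mul_eq_div, lt_div_iff₀ hpos]
      linarith
  refine ⟨-(N • M), N * u, fun y => ?_, hlt ?_⟩
  · by_cases hy : f y = ⊤
    · simp [hy]
    · refine ENNReal.ofReal_le_of_le_toReal ?_
      have h1 := hl' y hy _ le_rfl
      have h2 : (N * s) * (f y).toReal ≤ 1 * (f y).toReal := by gcongr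
      have h3 : N * u ≤ N * (M y + s * (f y).toReal) := by gcongr
      simp only [neg_apply, smul_apply, smul_eq_mul]
      linarith
  · simp only [neg_apply, smul_apply, smul_eq_mul]
    linarith

/-- A lower semicontinuous convex function with values in `[0, ∞]` is the supremum of the positive
parts of countably many affine functions. -/
theorem ConvexOn.exists_seq_affine_iSup_ennreal [SecondCountableTopology E] {f : E → ℝ≥0∞}
    (hf : ConvexOn ℝ≥0 Set.univ f) (hlsc : LowerSemicontinuous f) :
    ∃ (L : ℕ → E →L[ℝ] ℝ) (b : ℕ → ℝ), ∀ y, f y = ⨆ k, ENNReal.ofReal (L k y + b k) := by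
  let F : Set (E → ℝ≥0∞) := {h | ∃ (L : E →L[ℝ] ℝ) (b : ℝ),
    h = (fun y => ENNReal.ofReal (L y + b)) ∧ h ≤ f}
  have hF : IsLUB F f := by
    refine ⟨fun h ⟨_, _, _, hle⟩ => hle, fun g hg x => le_of_forall_lt fun c hc => ?_⟩
    obtain ⟨L, b, h1, h2⟩ := hf.exists_affine_minorant_ennreal hlsc hc
    exact h2.trans_le (hg ⟨L, b, rfl, h1⟩ x)
  have hcont : ∀ h ∈ F, LowerSemicontinuous h := by
    rintro h ⟨L, b, rfl, -⟩
    exact (ENNReal.continuous_ofReal.comp (by fun_prop)).lowerSemicontinuous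
  obtain ⟨F', hF'F, hF'c, hF'⟩ := exists_countable_lowerSemicontinuous_isLUB hcont hF
  -- Adding the zero function makes the family nonempty, so that `ℕ` can enumerate it.
  obtain ⟨e, he⟩ := (hF'c.insert (fun _ : E => (0 : ℝ≥0∞))).exists_eq_range (Set.insert_nonempty _ _)
  have h0F : (fun _ : E => (0 : ℝ≥0∞)) ∈ F := ⟨0, 0, by simp, fun y => zero_le⟩
  have hmem : ∀ k, e k ∈ F := fun k =>
    Set.insert_subset h0F hF'F (he ▸ Set.mem_range_self k)
  choose L b hLb hle using hmem
  refine ⟨L, b, fun y => le_antisymm ?_ (iSup_le fun k => ?_)⟩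
  · refine hF'.2 (show (fun y => ⨆ k, ENNReal.ofReal (L k y + b k)) ∈ upperBounds F' from
      fun h hh => ?_) y
    obtain ⟨k, rfl⟩ : h ∈ Set.range e := he ▸ Set.mem_insert_of_mem _ hh
    intro y
    refine le_trans (le_of_eq ?_) (le_iSup (fun k => ENNReal.ofReal (L k y + b k)) k)
    exact congrFun (hLb k) y
  · have := hle k y
    rwa [hLb k] at this

end ConvexEnvelope

/-! ### Integrals of pointwise suprema. -/

section Measure

variable {G : Type*} [TopologicalSpace G] [T2Space G] [SecondCountableTopology G]
  [LocallyCompactSpace G] [MeasurableSpace G] [BorelSpace G]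
  {μ : Measure G} [IsFiniteMeasureOnCompacts μ]

/-- The integral of a nonnegative function over a measurable set is the supremum of its integrals
over compact subsets. -/
theorem exists_isCompact_subset_lt_setLIntegral {B : Set G} (hB : MeasurableSet B) {ψ : G → ℝ≥0∞}
    (hψ : AEMeasurable ψ (μ.restrict B)) {c : ℝ≥0∞} (hc : c < ∫⁻ x in B, ψ x ∂μ) :
    ∃ K ⊆ B, IsCompact K ∧ c < ∫⁻ x in K, ψ x ∂μ := by
  -- Truncation gives a density measure that is finite on compact sets, so inner regularity applies
  -- to it.
  obtain ⟨M, hM⟩ : ∃ M : ℕ, c < ∫⁻ x in B, min (ψ x) M ∂μ := by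
    have h : ∫⁻ x in B, ψ x ∂μ = ⨆ M : ℕ, ∫⁻ x in B, min (ψ x) M ∂μ := by
      rw [← lintegral_iSup' (fun M => hψ.min aemeasurable_const)
        (Filter.Eventually.of_forall fun x M N hMN => by dsimp only; gcongr)]
      refine lintegral_congr fun x => ?_
      rw [← inf_iSup_eq, ENNReal.iSup_natCast, inf_top_eq]
    rw [h] at hc
    exact lt_iSup_iff.1 hc
  let g : G → ℝ≥0∞ := B.indicator fun x => min (ψ x) M
  let ν : Measure G := μ.withDensity g
  have : IsFiniteMeasureOnCompacts ν := by
    refine ⟨fun K hK => ?_⟩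
    have h1 : ν K ≤ ∫⁻ _ in K, M ∂μ := by
      rw [withDensity_apply' _ K]
      exact lintegral_mono fun x => Set.indicator_le' (fun _ _ => min_le_right _ _)
        (fun _ _ => zero_le) x
    refine h1.trans_lt ?_
    rw [setLIntegral_const]
    exact ENNReal.mul_lt_top (ENNReal.natCast_lt_top M) hK.measure_lt_top
  have hBν : c < ν B := by
    rw [withDensity_apply' _ B, setLIntegral_indicator hB, Set.inter_self]
    exact hM
  obtain ⟨K, hKB, hK, hcK⟩ := hB.exists_lt_isCompact hBν
  refine ⟨K, hKB, hK, hcK.trans_le ?_⟩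
  rw [withDensity_apply' _ K]
  exact lintegral_mono fun x => Set.indicator_le' (fun _ _ => min_le_left _ _)
    (fun _ _ => zero_le) x

/-- If the integrals of two families of functions over all open subsets of `A` are lower
semicontinuous in the parameter, so are those of the pointwise maximum. -/
theorem lowerSemicontinuous_setLIntegral_sup {T : Type*} [TopologicalSpace T] {A : Set G}
    {ψ₁ ψ₂ : T → G → ℝ≥0∞} (hm₁ : ∀ t, AEMeasurable (ψ₁ t) (μ.restrict A))
    (hm₂ : ∀ t, AEMeasurable (ψ₂ t) (μ.restrict A))
    (h₁ : ∀ U ⊆ A, IsOpen U → LowerSemicontinuous fun t => ∫⁻ x in U, ψ₁ t x ∂μ)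
    (h₂ : ∀ U ⊆ A, IsOpen U → LowerSemicontinuous fun t => ∫⁻ x in U, ψ₂ t x ∂μ)
    {U : Set G} (hUA : U ⊆ A) (hU : IsOpen U) :
    LowerSemicontinuous fun t => ∫⁻ x in U, (ψ₁ t x ⊔ ψ₂ t x) ∂μ := by
  intro t c hc
  have hm₁' := (hm₁ t).mono_measure (Measure.restrict_mono hUA le_rfl)
  have hm₂' := (hm₂ t).mono_measure (Measure.restrict_mono hUA le_rfl)
  let B : Set G := {x | hm₂'.mk _ x ≤ hm₁'.mk _ x}
  have hB : MeasurableSet B := measurableSet_le hm₂'.measurable_mk hm₁'.measurable_mk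
  have hae₁ : ∀ᵐ x ∂μ.restrict U, ψ₁ t x = hm₁'.mk _ x := hm₁'.ae_eq_mk
  have hae₂ : ∀ᵐ x ∂μ.restrict U, ψ₂ t x = hm₂'.mk _ x := hm₂'.ae_eq_mk
  have hsplit : ∫⁻ x in U, (ψ₁ t x ⊔ ψ₂ t x) ∂μ
      = ∫⁻ x in U ∩ B, ψ₁ t x ∂μ + ∫⁻ x in U \ B, ψ₂ t x ∂μ := by
    rw [← lintegral_inter_add_sdiff _ U hB]
    congr 1
    · refine setLIntegral_congr_fun_ae (hU.measurableSet.inter hB) ?_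
      rw [ae_restrict_iff' hU.measurableSet] at hae₁ hae₂
      filter_upwards [hae₁, hae₂] with x h1 h2 hx
      exact sup_eq_left.2 (by rw [h1 hx.1, h2 hx.1]; exact hx.2)
    · refine setLIntegral_congr_fun_ae (hU.measurableSet.diff hB) ?_
      rw [ae_restrict_iff' hU.measurableSet] at hae₁ hae₂
      filter_upwards [hae₁, hae₂] with x h1 h2 hx
      exact sup_eq_right.2 (by rw [h1 hx.1, h2 hx.1]; exact (not_le.1 hx.2).le)
  have hlow : ∀ s, ∀ U₁ ⊆ U, ∀ U₂ ⊆ U, IsOpen U₂ → Disjoint U₁ U₂ →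
      ∫⁻ x in U₁, ψ₁ s x ∂μ + ∫⁻ x in U₂, ψ₂ s x ∂μ
        ≤ ∫⁻ x in U, (ψ₁ s x ⊔ ψ₂ s x) ∂μ := by
    intro s U₁ hU₁ U₂ hU₂ hU₂o hd
    calc _ ≤ ∫⁻ x in U₁, (ψ₁ s x ⊔ ψ₂ s x) ∂μ + ∫⁻ x in U₂, (ψ₁ s x ⊔ ψ₂ s x) ∂μ :=
          add_le_add (lintegral_mono fun x => le_sup_left) (lintegral_mono fun x => le_sup_right)
      _ = ∫⁻ x in U₁ ∪ U₂, (ψ₁ s x ⊔ ψ₂ s x) ∂μ := (lintegral_union hU₂o.measurableSet hd).symm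
      _ ≤ _ := lintegral_mono_set (Set.union_subset hU₁ hU₂)
  dsimp only at hc
  rw [hsplit] at hc
  obtain ⟨K₁, K₂, hK₁B, hK₂B, hK₁, hK₂, hcK⟩ : ∃ K₁ K₂, K₁ ⊆ U ∩ B ∧ K₂ ⊆ U \ B ∧ IsCompact K₁ ∧
      IsCompact K₂ ∧ c < ∫⁻ x in K₁, ψ₁ t x ∂μ + ∫⁻ x in K₂, ψ₂ t x ∂μ := by
    have hn₁ := hm₁'.mono_measure (Measure.restrict_mono (Set.inter_subset_left (t := B)) le_rfl)
    have hn₂ := hm₂'.mono_measure (Measure.restrict_mono (Set.sdiff_subset (t := B)) le_rfl)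
    -- A summand equal to `0` leaves no room for a strictly smaller bound, so it is treated apart,
    -- with the empty compact set.
    rcases eq_or_ne (∫⁻ x in U ∩ B, ψ₁ t x ∂μ) 0 with h0 | h0
    · rw [h0, zero_add] at hc
      obtain ⟨K, h, hK, hcK⟩ := exists_isCompact_subset_lt_setLIntegral
        (hU.measurableSet.diff hB) hn₂ hc
      exact ⟨∅, K, Set.empty_subset _, h, isCompact_empty, hK, by simpa using hcK⟩
    rcases eq_or_ne (∫⁻ x in U \ B, ψ₂ t x ∂μ) 0 with h0' | h0'
    · rw [h0', add_zero] at hc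
      obtain ⟨K, h, hK, hcK⟩ := exists_isCompact_subset_lt_setLIntegral
        (hU.measurableSet.inter hB) hn₁ hc
      exact ⟨K, ∅, h, Set.empty_subset _, hK, isCompact_empty, by simpa using hcK⟩
    obtain ⟨c₁, hc₁, c₂, hc₂, hcc⟩ := ENNReal.exists_lt_add_of_lt_add hc h0 h0'
    obtain ⟨K₁, h₁, hK₁, hcK₁⟩ := exists_isCompact_subset_lt_setLIntegral
      (hU.measurableSet.inter hB) hn₁ hc₁
    obtain ⟨K₂, h₂, hK₂, hcK₂⟩ := exists_isCompact_subset_lt_setLIntegral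
      (hU.measurableSet.diff hB) hn₂ hc₂
    exact ⟨K₁, K₂, h₁, h₂, hK₁, hK₂, hcc.trans_le (add_le_add hcK₁.le hcK₂.le)⟩
  -- The hypotheses concern open sets only; disjoint neighbourhoods keep the two integrals additive
  -- for every nearby `s`.
  obtain ⟨W₁, W₂, hW₁, hW₂, hKW₁, hKW₂, hW⟩ := SeparatedNhds.of_isCompact_isCompact hK₁ hK₂
    (Set.disjoint_sdiff_right.mono (hK₁B.trans Set.inter_subset_right) hK₂B)
  have hlsc := (h₁ (U ∩ W₁) (Set.inter_subset_left.trans hUA) (hU.inter hW₁)).add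
    (h₂ (U ∩ W₂) (Set.inter_subset_left.trans hUA) (hU.inter hW₂))
  have hc' : c < ∫⁻ x in U ∩ W₁, ψ₁ t x ∂μ + ∫⁻ x in U ∩ W₂, ψ₂ t x ∂μ :=
    hcK.trans_le (add_le_add
      (lintegral_mono_set (Set.subset_inter (hK₁B.trans Set.inter_subset_left) hKW₁))
      (lintegral_mono_set (Set.subset_inter (hK₂B.trans Set.sdiff_subset) hKW₂)))
  filter_upwards [hlsc t c hc'] with s hs
  exact hs.trans_le (hlow s _ Set.inter_subset_left _ Set.inter_subset_left (hU.inter hW₂)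
    (hW.mono Set.inter_subset_right Set.inter_subset_right))

/-- If the integrals of countably many families of functions over all open subsets of `A` are lower
semicontinuous in the parameter, so are those of the pointwise supremum. -/
theorem lowerSemicontinuous_setLIntegral_iSup {T : Type*} [TopologicalSpace T] {A : Set G}
    {ψ : ℕ → T → G → ℝ≥0∞} (hm : ∀ k t, AEMeasurable (ψ k t) (μ.restrict A))
    (h : ∀ k, ∀ U ⊆ A, IsOpen U → LowerSemicontinuous fun t => ∫⁻ x in U, ψ k t x ∂μ)
    {U : Set G} (hUA : U ⊆ A) (hU : IsOpen U) :
    LowerSemicontinuous fun t => ∫⁻ x in U, ⨆ k, ψ k t x ∂μ := by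
  have key : ∀ N, (∀ t, AEMeasurable (fun x => partialSups (fun k => ψ k t x) N) (μ.restrict A)) ∧
      ∀ U ⊆ A, IsOpen U →
        LowerSemicontinuous fun t => ∫⁻ x in U, partialSups (fun k => ψ k t x) N ∂μ := by
    intro N
    induction N with
    | zero => simpa using ⟨hm 0, h 0⟩
    | succ N ih =>
      simp only [partialSups_add_one]
      exact ⟨fun t => (ih.1 t).sup (hm _ t), fun V hVA hV =>
        lowerSemicontinuous_setLIntegral_sup ih.1 (hm _) ih.2 (h _) hVA hV⟩
  have heq : (fun t => ∫⁻ x in U, ⨆ k, ψ k t x ∂μ)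
      = fun t => ⨆ N, ∫⁻ x in U, partialSups (fun k => ψ k t x) N ∂μ := by
    ext t
    rw [← lintegral_iSup']
    · simp only [iSup_partialSups_eq]
    · exact fun N => ((key N).1 t).mono_measure (Measure.restrict_mono hUA le_rfl)
    · exact Filter.Eventually.of_forall fun x => (partialSups _).monotone
  rw [heq]
  exact lowerSemicontinuous_iSup fun N => (key N).2 U hUA hU

end Measure

namespace Carnot

/-! ### Test functions and their invariant derivatives. -/

section TestFunctions

variable {n : ℕ} {G : Type*} [TopologicalSpace G] [ChartedSpace (EuclideanSpace ℝ (Fin n)) G]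

theorem IsTestFunction.mono {Ω Ω' : Set G} {φ : G → ℝ} (h : IsTestFunction n Ω φ) (hΩ : Ω ⊆ Ω') :
    IsTestFunction n Ω' φ :=
  ⟨h.smooth, h.hasCompactSupport, h.tsupport_subset.trans hΩ⟩

theorem exists_isTestFunction_one_on_isCompact [T2Space G] [LocallyCompactSpace G]
    [SigmaCompactSpace G] [IsManifold (𝓡 n) ∞ G] {K W : Set G} (hK : IsCompact K) (hW : IsOpen W)
    (hKW : K ⊆ W) :
    ∃ φ : G → ℝ, IsTestFunction n W φ ∧ (∀ x ∈ K, φ x = 1) ∧ ∀ x, φ x ∈ Set.Icc (0 : ℝ) 1 := by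
  obtain ⟨L, hL, hKL, hLW⟩ := exists_compact_between hK hW hKW
  obtain ⟨φ, h1, h0, h01⟩ := exists_contMDiffMap_one_nhds_of_subset_interior (n := (⊤ : ℕ∞)) (𝓡 n)
    hK.isClosed hKL
  have hsupp : tsupport φ ⊆ L := closure_minimal
    (fun x hx => by_contra fun hxL => hx (h0 x hxL)) hL.isClosed
  exact ⟨φ, ⟨φ.contMDiff, hL.of_isClosed_subset (isClosed_tsupport _) hsupp, hsupp.trans hLW⟩,
    fun x hx => h1.self_of_nhdsSet x hx, h01⟩

variable [Group G]

theorem tsupport_invDeriv_subset (v : GroupLieAlgebra (𝓡 n) G) (φ : G → ℝ) :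
    tsupport (invDeriv v φ) ⊆ tsupport φ := by
  refine closure_minimal (fun x hx => by_contra fun hxφ => hx ?_) (isClosed_tsupport _)
  have h : φ =ᶠ[nhds x] fun _ => 0 := notMem_tsupport_iff_eventuallyEq.1 hxφ
  unfold invDeriv
  rw [h.mfderiv_eq, mfderiv_const]
  rfl

theorem continuous_invDeriv [LieGroup (𝓡 n) ∞ G] (v : GroupLieAlgebra (𝓡 n) G) {φ : G → ℝ}
    (hφ : ContMDiff (𝓡 n) 𝓘(ℝ, ℝ) ∞ φ) : Continuous (invDeriv v φ) := by
  have : LieGroup (𝓡 n) (minSmoothness ℝ 3) G := LieGroup.of_le (n := ∞) (by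
    rw [minSmoothness_of_isRCLikeNormedField]; exact WithTop.coe_le_coe.2 (le_top (a := (3 : ℕ∞))))
  have hT : Continuous (tangentMap (𝓡 n) 𝓘(ℝ, ℝ) φ) := hφ.continuous_tangentMap (by simp)
  have hV := (contMDiff_mulInvariantVectorField v).continuous
  -- `invDeriv v φ` is the fibre coordinate of the tangent map of `φ` along the smooth section given
  -- by `v`.
  exact (tangentBundleModelSpaceHomeomorph 𝓘(ℝ, ℝ)).continuous.comp (hT.comp hV) |>.snd

end TestFunctions

/-! ### Pairing `L¹_loc` functions with test functions. -/

section Continuity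

variable {G : Type*} [TopologicalSpace G] [T2Space G] [MeasurableSpace G] [BorelSpace G]
  {μ : Measure G} {A : Set G}

theorem integrableOn_mul_of_locallyIntegrableOn {u ψ : G → ℝ}
    (hu : LocallyIntegrableOn u A μ) (hψ : Continuous ψ) (hψc : HasCompactSupport ψ)
    (hψA : tsupport ψ ⊆ A) : IntegrableOn (fun x => u x * ψ x) A μ := by
  have h1 : IntegrableOn (fun x => u x * ψ x) (tsupport ψ) μ :=
    (hu.integrableOn_compact_subset hψA hψc).mul_continuousOn hψ.continuousOn hψc
  refine ((integrableOn_iff_integrable_of_support_subset fun x hx => ?_).1 h1).integrableOn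
  exact subset_tsupport _ (right_ne_zero_of_mul hx)

/-- Integration against a continuous function with compact support in `A` is continuous on
`L¹_loc(A)`. -/
theorem L1loc.continuous_integral_mul (hA : IsOpen A) {ψ : G → ℝ} (hψ : Continuous ψ)
    (hψc : HasCompactSupport ψ) (hψA : tsupport ψ ⊆ A) :
    Continuous fun u : L1loc μ A => ∫ x in A, u.1 x * ψ x ∂μ := by
  obtain ⟨C, hC⟩ := hψc.exists_bound_of_continuous hψ
  have hint := fun u : L1loc μ A => integrableOn_mul_of_locallyIntegrableOn u.2 hψ hψc hψA
  refine continuous_iff_continuousAt.2 fun v => ?_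
  rw [ContinuousAt, EMetric.tendsto_nhds]
  intro ε hε
  -- The maximum with `1` keeps `D` nonzero, as the division by `D` requires.
  let D : ℝ≥0∞ := ENNReal.ofReal (max C 1)
  have hD0 : D ≠ 0 := by simp [D]
  have hDt : D ≠ ⊤ := ENNReal.ofReal_ne_top
  have hmem : {u : L1loc μ A | ∫⁻ x in tsupport ψ, ‖u.1 x - v.1 x‖ₑ ∂μ < ε / D} ∈ nhds v := by
    refine IsOpen.mem_nhds (TopologicalSpace.isOpen_generateFrom_of_mem
      ⟨v, tsupport ψ, ε / D, hψc, hψA, ENNReal.div_pos hε.ne' hDt, rfl⟩) ?_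
    simpa using ENNReal.div_pos hε.ne' hDt
  filter_upwards [hmem] with u hu
  rw [edist_eq_enorm_sub, ← integral_sub (hint u) (hint v)]
  have hu' : (∫⁻ x in tsupport ψ, ‖u.1 x - v.1 x‖ₑ ∂μ) * D < ε :=
    (ENNReal.lt_div_iff_mul_lt (Or.inl hD0) (Or.inl hDt)).1 hu
  refine (enorm_integral_le_lintegral_enorm _).trans_lt (lt_of_le_of_lt ?_ hu')
  rw [← lintegral_mul_const' _ _ hDt, ← lintegral_indicator hA.measurableSet,
    ← lintegral_indicator hψc.isClosed.measurableSet]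
  refine lintegral_mono fun x => ?_
  by_cases hx : x ∈ tsupport ψ
  · rw [Set.indicator_of_mem hx, Set.indicator_of_mem (hψA hx), ← sub_mul, enorm_mul]
    gcongr
    rw [← ofReal_norm]
    exact ENNReal.ofReal_le_ofReal ((hC x).trans (le_max_left _ _))
  · have : ψ x = 0 := image_eq_zero_of_notMem_tsupport hx
    refine le_of_eq_of_le (Set.indicator_apply_eq_zero.2 fun _ => ?_) zero_le
    simp [this]

/-- The easy half of the duality formula for the positive part: `h φ ≤ max h 0` when `0 ≤ φ ≤ 1`. -/
theorem IsTestFunction.ofReal_integral_mul_le {n : ℕ}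
    [ChartedSpace (EuclideanSpace ℝ (Fin n)) G] {U : Set G} {φ h : G → ℝ}
    (hφ : IsTestFunction n U φ) (hφ01 : ∀ x, φ x ∈ Set.Icc (0 : ℝ) 1) (hA : IsOpen A)
    (hUA : U ⊆ A) (hh : LocallyIntegrableOn h A μ) :
    ENNReal.ofReal (∫ x in A, h x * φ x ∂μ) ≤ ∫⁻ x in U, ENNReal.ofReal (h x) ∂μ := by
  have hUφ : ∫ x in A, h x * φ x ∂μ = ∫ x in U, h x * φ x ∂μ :=
    (setIntegral_eq_of_subset_of_forall_sdiff_eq_zero hA.measurableSet hUA fun x hx => by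
      rw [image_eq_zero_of_notMem_tsupport fun h' => hx.2 (hφ.tsupport_subset h'), mul_zero])
  have hint : IntegrableOn (fun x => h x * φ x) U μ :=
    integrableOn_mul_of_locallyIntegrableOn (hh.mono_set hUA) hφ.smooth.continuous
      hφ.hasCompactSupport hφ.tsupport_subset
  have hle : ∀ x, h x * φ x ≤ max (h x) 0 := fun x => by
    rcases le_total 0 (h x) with h0 | h0
    · exact (mul_le_of_le_one_right h0 (hφ01 x).2).trans (le_max_left _ _)
    · exact (mul_nonpos_of_nonpos_of_nonneg h0 (hφ01 x).1).trans (le_max_right _ _)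
  rw [hUφ]
  calc ENNReal.ofReal (∫ x in U, h x * φ x ∂μ)
      ≤ ENNReal.ofReal (∫ x in U, max (h x * φ x) 0 ∂μ) :=
        ENNReal.ofReal_le_ofReal (integral_mono hint hint.pos_part fun x => le_max_left _ _)
    _ = ∫⁻ x in U, ENNReal.ofReal (max (h x * φ x) 0) ∂μ :=
        ofReal_integral_eq_lintegral_ofReal hint.pos_part
          (Filter.Eventually.of_forall fun x => le_max_right _ _)
    _ ≤ _ := lintegral_mono fun x => by
        rw [← max_eq_left_iff.2 (le_refl (0:ℝ))]
        simpa [ENNReal.ofReal_max] using ENNReal.ofReal_le_ofReal (hle x)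

end Continuity

/-! ### Near-optimal test functions for the positive part. -/

section Localization

variable {n : ℕ} {G : Type*} [TopologicalSpace G] [T2Space G] [SecondCountableTopology G]
  [LocallyCompactSpace G] [ChartedSpace (EuclideanSpace ℝ (Fin n)) G] [IsManifold (𝓡 n) ∞ G]
  [MeasurableSpace G] [BorelSpace G] {μ : Measure G} [IsFiniteMeasureOnCompacts μ] {A : Set G}

/-- The integral of the positive part of a locally integrable function is approximated by the
integrals of the function against test functions with values in `[0, 1]`. -/
theorem exists_isTestFunction_lt_ofReal_integral_mul (hA : IsOpen A) {h : G → ℝ}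
    (hh : LocallyIntegrableOn h A μ) {U : Set G} (hU : IsOpen U) (hUA : U ⊆ A) {c : ℝ≥0∞}
    (hc : c < ∫⁻ x in U, ENNReal.ofReal (h x) ∂μ) :
    ∃ φ : G → ℝ, IsTestFunction n U φ ∧ (∀ x, φ x ∈ Set.Icc (0 : ℝ) 1) ∧
      c < ENNReal.ofReal (∫ x in A, h x * φ x ∂μ) := by
  have hhU : AEMeasurable h (μ.restrict U) := (hh.mono_set hUA).aestronglyMeasurable.aemeasurable
  let B : Set G := U ∩ {x | 0 < hhU.mk h x}
  have hB : MeasurableSet B :=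
    hU.measurableSet.inter (measurableSet_lt measurable_const hhU.measurable_mk)
  have hae : ∀ᵐ x ∂μ, x ∈ U → h x = hhU.mk h x :=
    (ae_restrict_iff' hU.measurableSet).1 hhU.ae_eq_mk
  have hUB : ∫⁻ x in U, ENNReal.ofReal (h x) ∂μ = ∫⁻ x in B, ENNReal.ofReal (h x) ∂μ := by
    rw [← lintegral_indicator hU.measurableSet, ← lintegral_indicator hB]
    refine lintegral_congr_ae (hae.mono fun x hx => ?_)
    by_cases hxU : x ∈ U
    · by_cases hxB : 0 < hhU.mk h x
      · simp [B, hxU, hxB]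
      · rw [Set.indicator_of_mem hxU, Set.indicator_of_notMem fun h' => hxB h'.2, hx hxU]
        exact ENNReal.ofReal_of_nonpos (not_lt.1 hxB)
    · simp [B, hxU]
  rw [hUB] at hc
  obtain ⟨K, hKB, hK, hcK⟩ := exists_isCompact_subset_lt_setLIntegral hB
    (hhU.mono_measure (Measure.restrict_mono Set.inter_subset_left le_rfl)).ennreal_ofReal hc
  have hKU : K ⊆ U := hKB.trans Set.inter_subset_left
  obtain ⟨L, hL, hKL, hLU⟩ := exists_compact_between hK hU hKU
  have hhL : IntegrableOn h L μ := hh.integrableOn_compact_subset (hLU.trans hUA) hL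
  have hhK : IntegrableOn h K μ := hhL.mono_set (hKL.trans interior_subset)
  have hpos : 0 ≤ᵐ[μ.restrict K] h := by
    refine (ae_restrict_iff' hK.measurableSet).2 (hae.mono fun x hx hxK => ?_)
    rw [Pi.zero_apply, hx (hKU hxK)]
    exact (hKB hxK).2.le
  rw [← ofReal_integral_eq_lintegral_ofReal hhK hpos] at hcK
  have hcK' : c.toReal < ∫ x in K, h x ∂μ := (ENNReal.lt_ofReal_iff_toReal_lt hcK.ne_top).1 hcK
  set ε : ℝ := (∫ x in K, h x ∂μ) - c.toReal with hε
  have hε0 : 0 < ε := sub_pos.2 hcK'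
  -- Outer regularity of `|h| dμ` on `L` gives an open `V ⊇ K` with little mass outside `K`. A
  -- cutoff equal to `1` on `K` and supported in `V ∩ interior L` then changes `∫ x in K, h x ∂μ` by
  -- less than `ε`.
  let ν : Measure G := (μ.restrict L).withDensity fun x => ‖h x‖ₑ
  have : IsFiniteMeasure ν := isFiniteMeasure_withDensity hhL.2.ne
  obtain ⟨V, hKV, hV, hVν⟩ := K.exists_isOpen_lt_add (μ := ν) (measure_ne_top ν K)
    (ENNReal.ofReal_pos.2 hε0).ne'
  have hVK : ν (V \ K) < ENNReal.ofReal ε :=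
    measure_sdiff_lt_of_lt_add hK.measurableSet.nullMeasurableSet hKV (measure_ne_top ν K) hVν
  obtain ⟨φ, hφ, hφ1, hφ01⟩ := exists_isTestFunction_one_on_isCompact (n := n) hK
    (hV.inter isOpen_interior) (Set.subset_inter hKV hKL)
  have hφ0 : ∀ x, x ∉ V ∩ interior L → φ x = 0 := fun x hx =>
    image_eq_zero_of_notMem_tsupport fun h' => hx (hφ.tsupport_subset h')
  have hφU : IsTestFunction n U φ :=
    hφ.mono (Set.inter_subset_right.trans (interior_subset.trans hLU))
  refine ⟨φ, hφU, hφ01, ?_⟩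
  have hAL : ∫ x in A, h x * φ x ∂μ = ∫ x in L, h x * φ x ∂μ :=
    setIntegral_eq_of_subset_of_forall_sdiff_eq_zero hA.measurableSet (hLU.trans hUA) fun x hx => by
      rw [hφ0 x fun h' => hx.2 (interior_subset h'.2), mul_zero]
  have hKL' : ∫ x in K, h x ∂μ = ∫ x in L, K.indicator h x ∂μ := by
    rw [setIntegral_indicator hK.measurableSet,
      Set.inter_eq_self_of_subset_right (hKL.trans interior_subset)]
  have hint : IntegrableOn (fun x => h x * φ x) L μ :=
    hhL.mul_continuousOn hφ.smooth.continuous.continuousOn hL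
  have hdiff : ‖(∫ x in A, h x * φ x ∂μ) - ∫ x in K, h x ∂μ‖ₑ < ENNReal.ofReal ε := by
    rw [hAL, hKL', ← integral_sub hint (hhL.indicator hK.measurableSet)]
    refine (enorm_integral_le_lintegral_enorm _).trans_lt (lt_of_le_of_lt ?_ hVK)
    rw [withDensity_apply _ (hV.measurableSet.diff hK.measurableSet),
      ← lintegral_indicator (hV.measurableSet.diff hK.measurableSet)]
    refine lintegral_mono fun x => ?_
    by_cases hxK : x ∈ K
    · simp [hxK, hφ1 x hxK]
    by_cases hxV : x ∈ V
    · rw [Set.indicator_of_notMem hxK, sub_zero, Set.indicator_of_mem (show x ∈ V \ K from ⟨hxV, hxK⟩), enorm_mul]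
      refine mul_le_of_le_one_right' ?_
      rw [← ofReal_norm, Real.norm_of_nonneg (hφ01 x).1]
      exact ENNReal.ofReal_le_one.2 (hφ01 x).2
    · simp [hxK, hφ0 x fun h' => hxV h'.1]
  rw [← ofReal_norm, ENNReal.ofReal_lt_ofReal_iff hε0, Real.norm_eq_abs] at hdiff
  rw [ENNReal.lt_ofReal_iff_toReal_lt hcK.ne_top]
  linarith [(abs_lt.1 hdiff).1]

end Localization

/-! ### Affine functions of the horizontal gradient. -/

section HorizontalGradient

variable {n m : ℕ} {G : Type*} [TopologicalSpace G] [ChartedSpace (EuclideanSpace ℝ (Fin n)) G]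
  [Group G] [MeasurableSpace G] {μ : Measure G} {A : Set G}
  {V : Submodule ℝ (GroupLieAlgebra (𝓡 n) G)} {X : Module.Basis (Fin m) ℝ V}

theorem locallyIntegrableOn_horizontalGradient (u : W11loc X μ A) :
    LocallyIntegrableOn (horizontalGradient u) A μ :=
  u.2.choose_spec.1

theorem isWeakHorizontalGradient_horizontalGradient (u : W11loc X μ A) :
    IsWeakHorizontalGradient X μ A u.1.1 (horizontalGradient u) :=
  u.2.choose_spec.2

variable [LocallyCompactSpace G] [IsFiniteMeasureOnCompacts μ]

theorem locallyIntegrableOn_affine_horizontalGradient (hA : IsOpen A)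
    (L : EuclideanSpace ℝ (Fin m) →L[ℝ] ℝ) (b : ℝ) (u : W11loc X μ A) :
    LocallyIntegrableOn (fun x => L (horizontalGradient u x) + b) A μ := by
  have hg := locallyIntegrableOn_horizontalGradient u
  refine (locallyIntegrableOn_iff hA.isLocallyClosed).2 fun K hKA hK => ?_
  exact (L.integrable_comp (hg.integrableOn_compact_subset hKA hK)).add
    (integrableOn_const hK.measure_lt_top.ne)

variable [T2Space G] [BorelSpace G]

/-- Integration by parts for an affine function of the horizontal gradient. -/
theorem integral_affine_horizontalGradient_mul (hA : IsOpen A)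
    (L : EuclideanSpace ℝ (Fin m) →L[ℝ] ℝ) (b : ℝ) {φ : G → ℝ} (hφ : IsTestFunction n A φ)
    (u : W11loc X μ A) :
    ∫ x in A, (L (horizontalGradient u x) + b) * φ x ∂μ
      = -∑ j, L (EuclideanSpace.single j 1) *
          ∫ x in A, u.1.1 x * invDeriv (X j : GroupLieAlgebra (𝓡 n) G) φ x ∂μ
        + ∫ x in A, b * φ x ∂μ := by
  have hint : ∀ j, IntegrableOn (fun x => horizontalGradient u x j * φ x) A μ := fun j =>
    integrableOn_mul_of_locallyIntegrableOn
      ((locallyIntegrableOn_iff hA.isLocallyClosed).2 fun K hKA hK =>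
        (EuclideanSpace.proj (𝕜 := ℝ) j).integrable_comp
          ((locallyIntegrableOn_horizontalGradient u).integrableOn_compact_subset hKA hK))
      hφ.smooth.continuous hφ.hasCompactSupport hφ.tsupport_subset
  have hb : IntegrableOn (fun x => b * φ x) A μ :=
    integrableOn_mul_of_locallyIntegrableOn
      ((locallyIntegrable_const b).locallyIntegrableOn A)
      hφ.smooth.continuous hφ.hasCompactSupport hφ.tsupport_subset
  have hL : ∀ y : EuclideanSpace ℝ (Fin m), L y = ∑ j, L (EuclideanSpace.single j 1) * y j := by
    intro y
    conv_lhs => rw [← (EuclideanSpace.basisFun (Fin m) ℝ).sum_repr y]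
    simp [mul_comm]
  have heq : ∀ x, (L (horizontalGradient u x) + b) * φ x
      = ∑ j, L (EuclideanSpace.single j 1) * (horizontalGradient u x j * φ x) + b * φ x := by
    intro x
    rw [add_mul, hL, Finset.sum_mul]
    simp only [mul_assoc]
  simp only [heq]
  rw [integral_add (integrable_finsetSum _ fun j _ => (hint j).const_mul _) hb,
    integral_finsetSum _ fun j _ => (hint j).const_mul _, ← Finset.sum_neg_distrib]
  congr 1
  refine Finset.sum_congr rfl fun j _ => ?_
  rw [integral_const_mul, isWeakHorizontalGradient_horizontalGradient u φ hφ j]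
  ring

variable [LieGroup (𝓡 n) ∞ G]

/-- After integration by parts only `u` itself appears, paired with the continuous functions `X_j
φ`; no control of the gradients is needed. -/
theorem continuous_integral_affine_horizontalGradient_mul (hA : IsOpen A)
    (L : EuclideanSpace ℝ (Fin m) →L[ℝ] ℝ) (b : ℝ) {φ : G → ℝ} (hφ : IsTestFunction n A φ) :
    Continuous fun u : W11loc X μ A =>
      ∫ x in A, (L (horizontalGradient u x) + b) * φ x ∂μ := by
  simp only [integral_affine_horizontalGradient_mul hA L b hφ]
  refine (continuous_finsetSum _ fun j _ => continuous_const.mul ?_).neg.add continuous_const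
  have hsub := tsupport_invDeriv_subset (X j : GroupLieAlgebra (𝓡 n) G) φ
  exact (L1loc.continuous_integral_mul hA (continuous_invDeriv _ hφ.smooth)
    (hφ.hasCompactSupport.of_isClosed_subset (isClosed_tsupport _) hsub)
    (hsub.trans hφ.tsupport_subset)).comp continuous_subtype_val

theorem lowerSemicontinuous_setLIntegral_affine_horizontalGradient
    [SecondCountableTopology G] (hA : IsOpen A)
    (L : EuclideanSpace ℝ (Fin m) →L[ℝ] ℝ) (b : ℝ) {U : Set G} (hUA : U ⊆ A) (hU : IsOpen U) :
    LowerSemicontinuous fun u : W11loc X μ A =>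
      ∫⁻ x in U, ENNReal.ofReal (L (horizontalGradient u x) + b) ∂μ := by
  intro u c hc
  obtain ⟨φ, hφ, hφ01, hcφ⟩ := exists_isTestFunction_lt_ofReal_integral_mul (n := n) hA
    (locallyIntegrableOn_affine_horizontalGradient hA L b u) hU hUA hc
  have hcont := ENNReal.continuous_ofReal.comp
    (continuous_integral_affine_horizontalGradient_mul (X := X) (μ := μ) hA L b (hφ.mono hUA))
  -- The `φ` chosen for `u` still witnesses the bound `c` for every nearby `w`.
  filter_upwards [hcont.continuousAt.eventually_const_lt hcφ] with w hw
  exact hw.trans_le (hφ.ofReal_integral_mul_le hφ01 hA hUA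
    (locallyIntegrableOn_affine_horizontalGradient hA L b w))

end HorizontalGradient

end Carnot

/-! ### The lower semicontinuity theorem. -/

theorem mainTheorem5 {n m : ℕ} {G : Type*}
    [TopologicalSpace G] [T2Space G] [SecondCountableTopology G] [SimplyConnectedSpace G]
    [ChartedSpace (EuclideanSpace ℝ (Fin n)) G] [Group G] [LieGroup (𝓡 n) ∞ G]
    [Group.IsNilpotent G]
    (S : Carnot.Stratification (GroupLieAlgebra (𝓡 n) G))
    (X : Module.Basis (Fin m) ℝ (S.layer 1))
    [MeasurableSpace G] [BorelSpace G] (μ : Measure G) [μ.IsHaarMeasure]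
    (f : EuclideanSpace ℝ (Fin m) → ℝ≥0∞)
    (hf_convex : ConvexOn ℝ≥0 Set.univ f) (hf_lsc : LowerSemicontinuous f)
    (A : Set G) (hA : IsOpen A) :
    LowerSemicontinuous
      (fun u : Carnot.W11loc X μ A => ∫⁻ x in A, f (Carnot.horizontalGradient u x) ∂μ) := by
  have : LocallyCompactSpace G := ChartedSpace.locallyCompactSpace (EuclideanSpace ℝ (Fin n)) G
  obtain ⟨L, b, hLb⟩ := hf_convex.exists_seq_affine_iSup_ennreal hf_lsc
  simp only [hLb]
  refine lowerSemicontinuous_setLIntegral_iSup (fun k u => ?_) (fun k U hUA hU =>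
    Carnot.lowerSemicontinuous_setLIntegral_affine_horizontalGradient hA (L k) (b k) hUA hU)
    subset_rfl hA
  exact (Carnot.locallyIntegrableOn_affine_horizontalGradient hA (L k) (b k) u
    ).aestronglyMeasurable.aemeasurable.ennreal_ofReal
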